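/- Let $[n]_3$ denote the set of ordered triples of pairwise distinct elements of $[n]=\{1,\dots,n\}$. A \emph{generalized signotope} on $n$ elements is a mapping $\chi\colon [n]_3\to\{+,-\}$ that is alternating, i.e. $\chi(i_{\sigma(1)},i_{\sigma(2)},i_{\sigma(3)})=\operatorname{sgn}(\sigma)\cdot\chi(i_1,i_2,i_3)$ for all distinct $i_1,i_2,i_3$ and all $\sigma\in S_3$, and such that the sequence $\chi(abc),\chi(abd),\chi(acd),\chi(bcd)$ has at most two sign changes for all pairwise distinct $a,b,c,d\in[n]$. Let $g(n)$ be the number of generalized signotopes on $n$ elements. Then, as $n\to\infty$, $$2^{c_1\binom n3+o(n^3)}\;\le\; g(n)\;\le\; 2^{c_2\binom n3}+o(1),$$ where $c_1=0.25$ and $c_2=\log_2(630\,988\,832)/35\approx 0.8352$ (that is, $|c_2-0.8352|<0.00005$). -/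

import Mathlib

open Filter Topology Asymptotics

/-- The number of sign changes of a sequence of four signs. -/
def signChanges (s : Fin 4 → ℤˣ) : ℕ :=
  (Finset.univ.filter fun i : Fin 3 => s i.castSucc ≠ s i.succ).card

/-- For a sign mapping `χ` on the ordered triples of pairwise distinct elements of an `n`-element
set and four pairwise distinct elements `a, b, c, d`, given as `q = (a, b, c, d)`,
the sequence `χ(abc), χ(abd), χ(acd), χ(bcd)`:
its `i`-th entry (for `i = 0, 1, 2, 3`) is obtained by omitting the entry `3 - i` of `q`. -/
def tripleSigns {n : ℕ} (χ : (Fin 3 ↪ Fin n) → ℤˣ) (q : Fin 4 ↪ Fin n) : Fin 4 → ℤˣ :=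
  fun i => χ ((Fin.succAboveEmb i.rev).trans q)

/-- A generalized signotope on `n` elements: a mapping from the ordered triples of pairwise
distinct elements to `{+1, -1}` that is alternating and has at most two sign changes in
`χ(abc), χ(abd), χ(acd), χ(bcd)` for all pairwise distinct `a, b, c, d`. -/
structure IsGeneralizedSignotope {n : ℕ} (χ : (Fin 3 ↪ Fin n) → ℤˣ) : Prop where
  alternating : ∀ (σ : Equiv.Perm (Fin 3)) (t : Fin 3 ↪ Fin n),
    χ (σ.toEmbedding.trans t) = Equiv.Perm.sign σ * χ t
  signChanges_le_two : ∀ q : Fin 4 ↪ Fin n, signChanges (tripleSigns χ q) ≤ 2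

/-- The number of generalized signotopes on `n` elements. -/
noncomputable def numGeneralizedSignotopes (n : ℕ) : ℕ :=
  Nat.card {χ : (Fin 3 ↪ Fin n) → ℤˣ // IsGeneralizedSignotope χ}

/-! Multiply the sign of the triple omitting the `k`-th point of a quadruple by `(-1)^k`. Three sign
changes mean that these four boundary signs agree; permuting the quadruple permutes them up to a
common sign, so only increasing quadruples matter.

Lower bound: place the points on a circle. Triangles separated by a diagonal of a quadrilateral
cannot both contain the centre. If all other increasing triples are positive, the central ones may
be signed freely, since every quadruple keeps a boundary sign of each value. About a quarter of all
triples are central.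

Upper bound: put a weight on the sign patterns of five points, positive on generalized signotopes.
For a pair `D`, sign the triples meeting `D` uniformly, and then each triple `t` disjoint from `D`
by the conditional weight on `D ∪ t`, whose other triples all meet `D`. This gives total mass at
most one (`sum_prod_factor_le_one`). In the product over all `D`, the factors regroup by five-sets
(`prod_powersetCard_disjoint`), each contributing at least `1/300` by a finite check. By AM-GM the
count is at most `300 ^ (C(n-2,3)/10)` times `2` to a quadratic power. As `300^7 < 630988832^2`,
this is eventually below the claimed bound, with no error term. -/

/-! ### Boundary signs and alternating extensions -/

theorem signChanges_le_two_iff (s : Fin 4 → ℤˣ) :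
    signChanges s ≤ 2 ↔ ∃ i j : Fin 4, (-1) ^ (i : ℕ) * s i ≠ (-1) ^ (j : ℕ) * s j := by
  revert s
  decide +kernel

/-- The cofactor sign rule: striking row `k` and column `τ k` from a permutation matrix. -/
theorem exists_perm_succAbove (τ : Equiv.Perm (Fin 4)) (k : Fin 4) :
    ∃ ρ : Equiv.Perm (Fin 3), (∀ i, τ (k.succAbove i) = (τ k).succAbove (ρ i)) ∧
      Equiv.Perm.sign ρ = Equiv.Perm.sign τ * ((-1) ^ (k : ℕ) * (-1) ^ ((τ k : Fin 4) : ℕ)) := by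
  revert τ k
  decide +kernel

/-- The sign of the triple omitting `q k`, multiplied with the parity of `k`. -/
def boundarySign {n : ℕ} (χ : (Fin 3 ↪ Fin n) → ℤˣ) (q : Fin 4 ↪ Fin n) (k : Fin 4) : ℤˣ :=
  (-1) ^ (k : ℕ) * χ ((Fin.succAboveEmb k).trans q)

theorem signChanges_tripleSigns_le_two_iff {n : ℕ} (χ : (Fin 3 ↪ Fin n) → ℤˣ) (q : Fin 4 ↪ Fin n) :
    signChanges (tripleSigns χ q) ≤ 2 ↔ ∃ i j, boundarySign χ q i ≠ boundarySign χ q j := by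
  have key : ∀ i : Fin 4, (-1) ^ (i : ℕ) * tripleSigns χ q i = -boundarySign χ q i.rev := by
    intro i
    have : ((-1 : ℤˣ)) ^ (i : ℕ) = -(-1) ^ (i.rev : ℕ) := by revert i; decide
    rw [this, boundarySign, tripleSigns, neg_mul]
  rw [signChanges_le_two_iff]
  simp only [key, ne_eq, neg_inj]
  constructor
  · rintro ⟨i, j, h⟩
    exact ⟨i.rev, j.rev, h⟩
  · rintro ⟨i, j, h⟩
    exact ⟨i.rev, j.rev, by simpa using h⟩

theorem boundarySign_perm {n : ℕ} {χ : (Fin 3 ↪ Fin n) → ℤˣ}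
    (hχ : ∀ (σ : Equiv.Perm (Fin 3)) (t : Fin 3 ↪ Fin n),
      χ (σ.toEmbedding.trans t) = Equiv.Perm.sign σ * χ t)
    (q : Fin 4 ↪ Fin n) (τ : Equiv.Perm (Fin 4)) (k : Fin 4) :
    boundarySign χ (τ.toEmbedding.trans q) k = Equiv.Perm.sign τ * boundarySign χ q (τ k) := by
  obtain ⟨ρ, h, hs⟩ := exists_perm_succAbove τ k
  have h1 : (Fin.succAboveEmb k).trans (τ.toEmbedding.trans q) =
      ρ.toEmbedding.trans ((Fin.succAboveEmb (τ k)).trans q) := by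
    ext i
    simp [h i]
  have h2 : ((-1 : ℤˣ)) ^ (k : ℕ) * (-1) ^ (k : ℕ) = 1 := by rw [← mul_pow]; simp
  rw [boundarySign, h1, hχ, hs, boundarySign]
  calc _ = ((-1 : ℤˣ) ^ (k : ℕ) * (-1) ^ (k : ℕ)) * (Equiv.Perm.sign τ *
        ((-1) ^ ((τ k : Fin 4) : ℕ) * χ ((Fin.succAboveEmb (τ k)).trans q))) := by
        simp only [mul_assoc, mul_left_comm]
    _ = _ := by rw [h2, one_mul]

theorem exists_perm_strictMono {k n : ℕ} (t : Fin k ↪ Fin n) :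
    ∃ (σ : Equiv.Perm (Fin k)) (s : Fin k ↪o Fin n), t = σ.toEmbedding.trans s.toEmbedding := by
  have hm : StrictMono (t ∘ Tuple.sort t) :=
    (Tuple.monotone_sort t).strictMono_of_injective (t.injective.comp (Equiv.injective _))
  refine ⟨(Tuple.sort t).symm, OrderEmbedding.ofStrictMono _ hm, ?_⟩
  ext i
  simp

/-- An alternating sign mapping is a generalized signotope as soon as no increasing quadruple has
three sign changes. -/
theorem isGeneralizedSignotope_of_increasing {n : ℕ} {χ : (Fin 3 ↪ Fin n) → ℤˣ}
    (hχ : ∀ (σ : Equiv.Perm (Fin 3)) (t : Fin 3 ↪ Fin n),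
      χ (σ.toEmbedding.trans t) = Equiv.Perm.sign σ * χ t)
    (h : ∀ q : Fin 4 ↪o Fin n, signChanges (tripleSigns χ q.toEmbedding) ≤ 2) :
    IsGeneralizedSignotope χ := by
  refine ⟨hχ, fun q => ?_⟩
  obtain ⟨τ, s, rfl⟩ := exists_perm_strictMono q
  obtain ⟨i, j, hij⟩ := (signChanges_tripleSigns_le_two_iff χ s.toEmbedding).1 (h s)
  rw [signChanges_tripleSigns_le_two_iff]
  refine ⟨τ.symm i, τ.symm j, ?_⟩
  simpa [boundarySign_perm hχ] using hij

/-- The alternating extension of a sign function on increasing triples. -/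
noncomputable def alternatingExtension {n : ℕ} (W : (Fin 3 → Fin n) → ℤˣ) (t : Fin 3 ↪ Fin n) : ℤˣ :=
  Equiv.Perm.sign (Tuple.sort t) * W (t ∘ Tuple.sort t)

theorem sort_comp_perm {k n : ℕ} (t : Fin k ↪ Fin n) (σ : Equiv.Perm (Fin k)) :
    Tuple.sort (t ∘ σ) = σ⁻¹ * Tuple.sort t := by
  have h1 : (t ∘ σ) ∘ Tuple.sort (t ∘ σ) = t ∘ Tuple.sort t := by
    rw [Tuple.comp_perm_comp_sort_eq_comp_sort]
  ext i
  have h2 := congrFun h1 i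
  simp only [Function.comp_apply, EmbeddingLike.apply_eq_iff_eq] at h2
  rw [Equiv.Perm.mul_apply, ← h2]
  simp

theorem alternatingExtension_alternating {n : ℕ} (W : (Fin 3 → Fin n) → ℤˣ)
    (σ : Equiv.Perm (Fin 3)) (t : Fin 3 ↪ Fin n) :
    alternatingExtension W (σ.toEmbedding.trans t) =
      Equiv.Perm.sign σ * alternatingExtension W t := by
  have h : ⇑(σ.toEmbedding.trans t) = t ∘ σ := rfl
  have h1 : (t ∘ σ) ∘ Tuple.sort (t ∘ σ) = t ∘ Tuple.sort t := by
    rw [Tuple.comp_perm_comp_sort_eq_comp_sort]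
  rw [alternatingExtension, alternatingExtension, h, h1, sort_comp_perm]
  simp [mul_assoc]

theorem alternatingExtension_of_strictMono {n : ℕ} (W : (Fin 3 → Fin n) → ℤˣ)
    (t : Fin 3 ↪ Fin n) (ht : StrictMono t) : alternatingExtension W t = W t := by
  have : Tuple.sort t = 1 := Tuple.sort_eq_refl_iff_monotone.2 ht.monotone
  rw [alternatingExtension, this]
  simp

/-! ### Lower bound: triangles containing the centre -/

/-- The increasing triples whose three cyclic gaps on a circle of `2 * m + 1` points are all at most
`m`: the triangles containing the centre of the circle. -/
def centralTriples (n m : ℕ) : Finset (Fin 3 → Fin n) :=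
  Finset.univ.filter fun t => StrictMono t ∧ (t 1 : ℕ) ≤ t 0 + m ∧ (t 2 : ℕ) ≤ t 1 + m ∧
    (t 0 : ℕ) + m < t 2

/-- The signs that are negative exactly on the set `B`. -/
def negativeOn {n : ℕ} (B : Finset (Fin 3 → Fin n)) (t : Fin 3 → Fin n) : ℤˣ :=
  if t ∈ B then -1 else 1

theorem isGeneralizedSignotope_alternatingExtension {n m : ℕ} {B : Finset (Fin 3 → Fin n)}
    (hB : B ⊆ centralTriples n m) :
    IsGeneralizedSignotope (alternatingExtension (negativeOn B)) := by
  refine isGeneralizedSignotope_of_increasing (alternatingExtension_alternating _) fun q => ?_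
  have hmono : ∀ k : Fin 4, StrictMono ((Fin.succAboveEmb k).trans q.toEmbedding) := fun k =>
    q.strictMono.comp (Fin.strictMono_succAbove k)
  have hplus : ∀ k : Fin 4, ⇑((Fin.succAboveEmb k).trans q.toEmbedding) ∉ centralTriples n m →
      boundarySign (alternatingExtension (negativeOn B)) q.toEmbedding k = (-1) ^ (k : ℕ) := by
    intro k hk
    rw [boundarySign, alternatingExtension_of_strictMono _ _ (hmono k), negativeOn,
      if_neg (fun h => hk (hB h)), mul_one]
  have hcentral : ∀ k : Fin 4, ⇑((Fin.succAboveEmb k).trans q.toEmbedding) ∈ centralTriples n m →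
      (q (k.succAbove 1) : ℕ) ≤ q (k.succAbove 0) + m ∧
      (q (k.succAbove 2) : ℕ) ≤ q (k.succAbove 1) + m ∧
      (q (k.succAbove 0) : ℕ) + m < q (k.succAbove 2) := fun k hk =>
    (Finset.mem_filter.1 hk).2.2
  -- Omitting 0 or 2 leaves triangles on opposite sides of the diagonal 13: one being central needs
  -- `q 3 - q 1 > m`, the other `q 3 - q 1 ≤ m`. For `h13` the diagonal is 02.
  have h02 : ∃ k : Fin 4, (-1 : ℤˣ) ^ (k : ℕ) = 1 ∧
      ⇑((Fin.succAboveEmb k).trans q.toEmbedding) ∉ centralTriples n m := by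
    by_contra! hc
    have h1 := hcentral 0 (hc 0 (by decide))
    have h2 := hcentral 2 (hc 2 (by decide))
    simp only [show Fin.succAbove (0 : Fin 4) 0 = 1 from rfl,
      show Fin.succAbove (0 : Fin 4) 1 = 2 from rfl, show Fin.succAbove (0 : Fin 4) 2 = 3 from rfl,
      show Fin.succAbove (2 : Fin 4) 0 = 0 from rfl, show Fin.succAbove (2 : Fin 4) 1 = 1 from rfl,
      show Fin.succAbove (2 : Fin 4) 2 = 3 from rfl] at h1 h2
    omega
  have h13 : ∃ k : Fin 4, (-1 : ℤˣ) ^ (k : ℕ) = -1 ∧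
      ⇑((Fin.succAboveEmb k).trans q.toEmbedding) ∉ centralTriples n m := by
    by_contra! hc
    have h1 := hcentral 1 (hc 1 (by decide))
    have h2 := hcentral 3 (hc 3 (by decide))
    simp only [show Fin.succAbove (1 : Fin 4) 0 = 0 from rfl,
      show Fin.succAbove (1 : Fin 4) 1 = 2 from rfl, show Fin.succAbove (1 : Fin 4) 2 = 3 from rfl,
      show Fin.succAbove (3 : Fin 4) 0 = 0 from rfl, show Fin.succAbove (3 : Fin 4) 1 = 1 from rfl,
      show Fin.succAbove (3 : Fin 4) 2 = 2 from rfl] at h1 h2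
    omega
  obtain ⟨i, hi, hi'⟩ := h02
  obtain ⟨j, hj, hj'⟩ := h13
  rw [signChanges_tripleSigns_le_two_iff]
  refine ⟨i, j, ?_⟩
  rw [hplus i hi', hplus j hj', hi, hj]
  decide

theorem two_pow_card_centralTriples_le (n m : ℕ) :
    2 ^ (centralTriples n m).card ≤ numGeneralizedSignotopes n := by
  rw [← Finset.card_powerset, ← Nat.card_eq_finsetCard, numGeneralizedSignotopes]
  refine Nat.card_le_card_of_injective
    (fun B : (centralTriples n m).powerset => (⟨_,
      isGeneralizedSignotope_alternatingExtension (Finset.mem_powerset.1 B.2)⟩ :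
        {χ : (Fin 3 ↪ Fin n) → ℤˣ // IsGeneralizedSignotope χ})) ?_
  rintro ⟨B, hB⟩ ⟨C, hC⟩ h
  rw [Finset.mem_powerset] at hB hC
  have h' := congrFun (congrArg Subtype.val h)
  ext t
  have main : ∀ ht : t ∈ centralTriples n m, (t ∈ B ↔ t ∈ C) := by
    intro ht
    have hm : StrictMono t := (Finset.mem_filter.1 ht).2.1
    have h1 := h' ⟨t, hm.injective⟩
    simp only [] at h1
    rw [alternatingExtension_of_strictMono _ _ hm, alternatingExtension_of_strictMono _ _ hm] at h1
    simp only [negativeOn, Function.Embedding.coeFn_mk] at h1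
    by_cases hb : t ∈ B <;> by_cases hc : t ∈ C <;> simp_all
  exact ⟨fun hb => (main (hB hb)).1 hb, fun hc => (main (hC hc)).2 hc⟩

theorem sum_sq_le_card_centralTriples {n m : ℕ} (h : 2 * m + 1 ≤ n) :
    ∑ j ∈ Finset.range (m + 1), j ^ 2 ≤ (centralTriples n m).card := by
  have hcard : ∑ j ∈ Finset.range (m + 1), j ^ 2 =
      ((Finset.range (m + 1)).sigma fun j => Finset.range j ×ˢ Finset.range j).card := by
    simp [sq]
  rw [hcard]
  refine Finset.card_le_card_of_forall_subsingleton
    (fun p t => (t 0 : ℕ) = p.2.1 ∧ (t 1 : ℕ) + p.1 = p.2.1 + (m + 1) + p.2.2 ∧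
      (t 2 : ℕ) + p.1 = p.2.1 + 2 * m + 1) ?_ ?_
  · rintro ⟨j, a, i⟩ hp
    simp only [Finset.mem_sigma, Finset.mem_range, Finset.mem_product] at hp
    -- Here `j` is the cyclic gap from the last point back to the first; it leaves `j` choices for
    -- the first point `a` and `j` for the middle one.
    refine ⟨![⟨a, by omega⟩, ⟨a + (m + 1) + i - j, by omega⟩, ⟨a + 2 * m + 1 - j, by omega⟩],
      Finset.mem_filter.2 ⟨Finset.mem_univ _, ?_, ?_⟩, ?_⟩
    · rw [Fin.strictMono_iff_lt_succ]
      intro k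
      fin_cases k <;> simp [Fin.lt_def] <;> omega
    · simp
      omega
    · simp
      omega
  · rintro t - ⟨j, a, i⟩ ⟨hp, hpt⟩ ⟨j', a', i'⟩ ⟨hp', hpt'⟩
    dsimp only at hpt hpt'
    obtain ⟨rfl, rfl, rfl⟩ : j = j' ∧ a = a' ∧ i = i' := by omega
    rfl

theorem choose_three_le_card_centralTriples (n : ℕ) :
    n.choose 3 ≤ 4 * (centralTriples n ((n - 1) / 2)).card := by
  rcases n with _ | n
  · simp
  have h := sum_sq_le_card_centralTriples (n := n + 1) (m := n / 2) (by omega)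
  have hs : ∀ m : ℕ, 6 * ∑ j ∈ Finset.range (m + 1), j ^ 2 = m * (m + 1) * (2 * m + 1) := by
    intro m
    induction m with
    | zero => simp
    | succ m ih => rw [Finset.sum_range_succ, mul_add, ih]; ring
  have hc : 6 * (n + 1).choose 3 = (n + 1) * n * (n - 1) := by
    have := Nat.descFactorial_eq_factorial_mul_choose (n + 1) 3
    simp [Nat.descFactorial, Nat.factorial] at this
    rw [← this]; ring
  have hn : (n + 1) * n * (n - 1) ≤ 4 * (n / 2 * (n / 2 + 1) * (2 * (n / 2) + 1)) := by
    calc (n + 1) * n * (n - 1) ≤ (2 * (n / 2) + 2) * (2 * (n / 2) + 1) * (2 * (n / 2)) := by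
          exact Nat.mul_le_mul (Nat.mul_le_mul (by omega) (by omega)) (by omega)
      _ = _ := by ring
  have := hs (n / 2)
  simp only [Nat.add_sub_cancel]
  linarith

theorem two_rpow_quarter_choose_three_le (n : ℕ) :
    (2 : ℝ) ^ ((0.25 : ℝ) * (n.choose 3 : ℝ)) ≤ numGeneralizedSignotopes n := by
  have h : (n.choose 3 : ℝ) ≤ 4 * (centralTriples n ((n - 1) / 2)).card := mod_cast
    choose_three_le_card_centralTriples n
  calc (2 : ℝ) ^ ((0.25 : ℝ) * (n.choose 3 : ℝ))
      ≤ (2 : ℝ) ^ ((centralTriples n ((n - 1) / 2)).card : ℝ) :=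
        Real.rpow_le_rpow_of_exponent_le (by norm_num) (by linarith)
    _ ≤ _ := by
      rw [Real.rpow_natCast]
      exact_mod_cast two_pow_card_centralTriples_le n _

/-! ### Upper bound: weights on five-element patterns -/

/-- Whether the sequence `a, b, c, d` is alternating. -/
def isAlternating (a b c d : Bool) : Bool :=
  cond a (!b && c && !d) (b && !c && d)

/-- Whether the sequence `a, !b, c, !d` has two positive and two negative entries. -/
def isBalanced (a b c d : Bool) : Bool :=
  cond a (cond b (c == d) (!c && d)) (cond b (c && !d) (c == d))

/-- The weight of the sign pattern on five elements whose triples, taken lexicographically, have the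
signs `b0, …, b9`: zero if the pattern is not a generalized signotope, and otherwise three plus the
number of its quadruples with two positive and two negative boundary signs. -/
def weight (b0 b1 b2 b3 b4 b5 b6 b7 b8 b9 : Bool) : ℕ :=
  cond (isAlternating b0 b1 b3 b6 || isAlternating b0 b2 b4 b7 || isAlternating b1 b2 b5 b8 ||
    isAlternating b3 b4 b5 b9 || isAlternating b6 b7 b8 b9) 0
  (3 + ((isBalanced b0 b1 b3 b6).toNat + (isBalanced b0 b2 b4 b7).toNat +
    (isBalanced b1 b2 b5 b8).toNat + (isBalanced b3 b4 b5 b9).toNat +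
    (isBalanced b6 b7 b8 b9).toNat))

/-- Divided by `w ^ 10`, this bounds the product of the inverse conditional probabilities of the ten
signs; a sign whose change is forbidden contributes a factor one. It is checked on all 1024
patterns. -/
theorem prod_weight_add_le_of_bool : ∀ b0 b1 b2 b3 b4 b5 b6 b7 b8 b9 : Bool,
    let w := weight b0 b1 b2 b3 b4 b5 b6 b7 b8 b9
    w ≠ 0 →
    (w + weight (!b0) b1 b2 b3 b4 b5 b6 b7 b8 b9) * (w + weight b0 (!b1) b2 b3 b4 b5 b6 b7 b8 b9) *
    (w + weight b0 b1 (!b2) b3 b4 b5 b6 b7 b8 b9) * (w + weight b0 b1 b2 (!b3) b4 b5 b6 b7 b8 b9) *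
    (w + weight b0 b1 b2 b3 (!b4) b5 b6 b7 b8 b9) * (w + weight b0 b1 b2 b3 b4 (!b5) b6 b7 b8 b9) *
    (w + weight b0 b1 b2 b3 b4 b5 (!b6) b7 b8 b9) * (w + weight b0 b1 b2 b3 b4 b5 b6 (!b7) b8 b9) *
    (w + weight b0 b1 b2 b3 b4 b5 b6 b7 (!b8) b9) * (w + weight b0 b1 b2 b3 b4 b5 b6 b7 b8 (!b9)) ≤
    300 * (w * w * w * w * w * w * w * w * w * w) := by
  decide +kernel

attribute [irreducible] weight

/-- The weight of a sign pattern on five elements, indexed as in `weight`. -/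
def patternWeight (x : Fin 10 → Bool) : ℕ :=
  weight (x 0) (x 1) (x 2) (x 3) (x 4) (x 5) (x 6) (x 7) (x 8) (x 9)

/-- The pattern obtained by changing the sign at `t`. -/
def flipAt {ι : Type*} [DecidableEq ι] (t : ι) (x : ι → Bool) : ι → Bool :=
  Function.update x t (!x t)

theorem flipAt_flipAt {ι : Type*} [DecidableEq ι] (t : ι) (x : ι → Bool) :
    flipAt t (flipAt t x) = x := by
  simp [flipAt]

theorem prod_patternWeight_add_le (x : Fin 10 → Bool) (hx : patternWeight x ≠ 0) :
    ∏ i, (patternWeight x + patternWeight (flipAt i x)) ≤ 300 * patternWeight x ^ 10 := by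
  have h := prod_weight_add_le_of_bool _ _ _ _ _ _ _ _ _ _ hx
  simp only [pow_succ, pow_zero, one_mul]
  refine le_trans (le_of_eq ?_) h
  simp only [Fin.prod_univ_succ, Fin.prod_univ_zero, mul_one, ← mul_assoc]
  rfl

theorem one_div_le_prod_patternWeight (x : Fin 10 → Bool) (hx : patternWeight x ≠ 0) :
    (1 / 300 : ℝ) ≤ ∏ i, (patternWeight x : ℝ) / (patternWeight x + patternWeight (flipAt i x)) := by
  have h : ((∏ i, (patternWeight x + patternWeight (flipAt i x)) : ℕ) : ℝ) ≤
      (300 * patternWeight x ^ 10 : ℕ) := mod_cast prod_patternWeight_add_le x hx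
  have hx' : (0 : ℝ) < patternWeight x := mod_cast Nat.pos_of_ne_zero hx
  rw [Finset.prod_div_distrib, div_le_div_iff₀ (by norm_num) (by positivity)]
  push_cast at h
  simpa [mul_comm] using h

/-! ### Product bounds and geometric means -/

/-- The average of products of conditional weights over all assignments is at most one, if each
factor `p t` only depends on the values on `A ∪ {t}` (only on the value at `t` for `t ∈ A`). -/
theorem sum_prod_le_one {ι : Type*} [Fintype ι] [DecidableEq ι] (A : Finset ι)
    (p : ι → (ι → Bool) → ℝ) (hp : ∀ t x, 0 ≤ p t x)
    (hA : ∀ t ∈ A, ∀ x y, x t = y t → p t x = p t y)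
    (hAc : ∀ t ∉ A, ∀ x y, (∀ s ∈ A, x s = y s) → x t = y t → p t x = p t y)
    (hsum : ∀ t x, p t x + p t (flipAt t x) ≤ 1) :
    ∑ x, ∏ t, p t x ≤ 1 := by
  classical
  have hsum' : ∀ t x, ∑ b : Bool, p t (Function.update x t b) ≤ 1 := by
    intro t x
    have h := hsum t (Function.update x t true)
    simpa [flipAt] using h
  let e := Equiv.piEquivPiSubtypeProd (· ∈ A) (fun _ : ι => Bool)
  let z : ({t // t ∈ A} → Bool) → ι → Bool := fun a => e.symm (a, fun _ => true)
  -- Coordinates on which a factor does not depend are reset to `true`; then the sum over `b`, and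
  -- afterwards the one over `a`, splits into a product.
  have key : ∀ a b, ∏ t, p t (e.symm (a, b)) =
      (∏ t : {t // t ∈ A}, p t (Function.update (fun _ => true) t (a t))) *
        ∏ t : {t // t ∉ A}, p t (Function.update (z a) t (b t)) := by
    intro a b
    rw [← Fintype.prod_subtype_mul_prod_subtype (· ∈ A)]
    refine congrArg₂ _ ?_ ?_
    · refine Finset.prod_congr (by ext; simp) fun t _ => hA t.1 t.2 _ _ ?_
      simp [e, Equiv.piEquivPiSubtypeProd]
    · refine Finset.prod_congr (by ext; simp) fun t _ => hAc t.1 t.2 _ _ ?_ ?_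
      · intro s hs
        have : s ≠ t := fun h => t.2 (h ▸ hs)
        simp [e, z, Equiv.piEquivPiSubtypeProd, hs, this]
      · simp [e, Equiv.piEquivPiSubtypeProd, t.2]
  rw [← e.symm.sum_comp, Fintype.sum_prod_type]
  simp only [key, ← Finset.mul_sum]
  have hin : ∀ a, ∑ b : {t // t ∉ A} → Bool, ∏ t : {t // t ∉ A}, p t (Function.update (z a) t (b t))
      ≤ 1 := by
    intro a
    rw [← Fintype.prod_sum fun (t : {t // t ∉ A}) (c : Bool) => p t (Function.update (z a) t c)]
    exact Finset.prod_le_one (fun t _ => Finset.sum_nonneg fun _ _ => hp _ _) fun t _ => hsum' _ _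
  calc _ ≤ ∑ a : {t // t ∈ A} → Bool,
        ∏ t : {t // t ∈ A}, p t (Function.update (fun _ => true) t (a t)) :=
        Finset.sum_le_sum fun a _ =>
          mul_le_of_le_one_right (Finset.prod_nonneg fun _ _ => hp _ _) (hin a)
    _ = ∏ t : {t // t ∈ A}, ∑ c : Bool, p t (Function.update (fun _ => true) t c) :=
        (Fintype.prod_sum fun (t : {t // t ∈ A}) (c : Bool) =>
          p t (Function.update (fun _ => true) t c)).symm
    _ ≤ 1 :=
      Finset.prod_le_one (fun t _ => Finset.sum_nonneg fun _ _ => hp _ _) fun t _ => hsum' _ _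

/-- If the nonnegative functions `r D` have sum at most one on `S`, and their geometric mean is at
least `ρ` everywhere on `S`, then `S` has at most `ρ⁻¹` elements. -/
theorem card_mul_le_one_of_geom_mean {α δ : Type*} (S : Finset α) (I : Finset δ) (hI : I.Nonempty)
    (r : δ → α → ℝ) (hr : ∀ D x, 0 ≤ r D x) (hsum : ∀ D ∈ I, ∑ x ∈ S, r D x ≤ 1) {ρ : ℝ}
    (hρ : 0 ≤ ρ) (h : ∀ x ∈ S, ρ ^ I.card ≤ ∏ D ∈ I, r D x) : S.card * ρ ≤ 1 := by
  have hN : (0 : ℝ) < I.card := mod_cast hI.card_pos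
  have hmean : ∀ x ∈ S, I.card * ρ ≤ ∑ D ∈ I, r D x := by
    intro x hx
    have h1 := Real.geom_mean_le_arith_mean I (fun _ => 1) (fun D => r D x) (fun _ _ => zero_le_one)
      (by simpa using hI.card_pos) (fun D _ => hr D x)
    simp only [Real.rpow_one, Finset.sum_const, nsmul_eq_mul, mul_one, one_mul] at h1
    have h2 : ρ ≤ (∏ D ∈ I, r D x) ^ ((I.card : ℝ)⁻¹) := by
      calc ρ = (ρ ^ I.card) ^ ((I.card : ℝ)⁻¹) :=
            (Real.pow_rpow_inv_natCast hρ hI.card_pos.ne').symm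
        _ ≤ _ := Real.rpow_le_rpow (by positivity) (h x hx) (by positivity)
    have h3 := h2.trans h1
    rwa [le_div_iff₀ hN, mul_comm] at h3
  have h1 : S.card * (I.card * ρ) ≤ I.card := by
    calc (S.card * (I.card * ρ) : ℝ) = ∑ x ∈ S, I.card * ρ := by simp
      _ ≤ ∑ x ∈ S, ∑ D ∈ I, r D x := Finset.sum_le_sum hmean
      _ = ∑ D ∈ I, ∑ x ∈ S, r D x := Finset.sum_comm
      _ ≤ ∑ D ∈ I, 1 := Finset.sum_le_sum hsum
      _ = I.card := by simp
  nlinarith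

/-! ### Averaging over pairs in 3-uniform hypergraphs -/

/-- The triples of a five-element set, lexicographically. -/
def triple : Fin 10 → Finset (Fin 5) :=
  ![{0, 1, 2}, {0, 1, 3}, {0, 1, 4}, {0, 2, 3}, {0, 2, 4}, {0, 3, 4}, {1, 2, 3}, {1, 2, 4},
    {1, 3, 4}, {2, 3, 4}]

theorem triple_injective : Function.Injective triple := by decide +kernel

theorem image_triple : Finset.univ.image triple = Finset.powersetCard 3 Finset.univ := by
  decide +kernel

theorem card_triple (i : Fin 10) : (triple i).card = 3 := by
  revert i; decide

/-- The sign pattern of `H` on the five-element set `K`. -/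
def pattern {n : ℕ} (K : Finset (Fin n)) (H : Finset (Fin n) → Bool) (i : Fin 10) : Bool :=
  if h : K.card = 5 then H ((triple i).map (K.orderEmbOfFin h).toEmbedding) else false

theorem pattern_flipAt {n : ℕ} {K : Finset (Fin n)} (h : K.card = 5) (H : Finset (Fin n) → Bool)
    (i : Fin 10) : pattern K (flipAt ((triple i).map (K.orderEmbOfFin h).toEmbedding) H) =
      flipAt i (pattern K H) := by
  ext j
  by_cases hij : j = i
  · subst hij
    simp [pattern, flipAt, h]
  · have : triple j ≠ triple i := fun hc => hij (triple_injective hc)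
    simp [pattern, flipAt, h, hij, this]

theorem pattern_congr {n : ℕ} {K : Finset (Fin n)} {G H : Finset (Fin n) → Bool}
    (hGH : ∀ t ⊆ K, t.card = 3 → G t = H t) : pattern K G = pattern K H := by
  ext i
  rw [pattern, pattern]
  split_ifs with h
  · refine hGH _ ?_ (by rw [Finset.card_map, card_triple])
    intro x hx
    obtain ⟨y, -, rfl⟩ := Finset.mem_map.1 hx
    exact K.orderEmbOfFin_mem h y
  · rfl

/-- The conditional weight of the sign at `t`, given the other signs on `K`. -/
noncomputable def conditionalWeight {n : ℕ} (K t : Finset (Fin n)) (H : Finset (Fin n) → Bool) : ℝ :=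
  (patternWeight (pattern K H) : ℝ) /
    (patternWeight (pattern K H) + patternWeight (pattern K (flipAt t H)))

theorem conditionalWeight_nonneg {n : ℕ} (K t : Finset (Fin n)) (H : Finset (Fin n) → Bool) :
    0 ≤ conditionalWeight K t H := by
  unfold conditionalWeight; positivity

theorem conditionalWeight_add_le_one {n : ℕ} (K t : Finset (Fin n)) (H : Finset (Fin n) → Bool) :
    conditionalWeight K t H + conditionalWeight K t (flipAt t H) ≤ 1 := by
  rw [conditionalWeight, conditionalWeight, flipAt_flipAt,
    add_comm (patternWeight (pattern K (flipAt t H)) : ℝ), ← add_div]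
  -- Only an inequality: if both weights vanish, the quotient is `0 / 0 = 0`.
  exact div_self_le_one _

theorem conditionalWeight_congr {n : ℕ} {K t : Finset (Fin n)} {G H : Finset (Fin n) → Bool}
    (hGH : ∀ s ⊆ K, s.card = 3 → G s = H s) : conditionalWeight K t G = conditionalWeight K t H := by
  by_cases ht : t ⊆ K ∧ t.card = 3
  · rw [conditionalWeight, conditionalWeight, pattern_congr hGH,
      pattern_congr (G := flipAt t G) (H := flipAt t H)]
    intro s hs hs3
    by_cases hst : s = t
    · subst hst; simp [flipAt, hGH s hs hs3]
    · simp [flipAt, hst, hGH s hs hs3]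
  · have h : ∀ F : Finset (Fin n) → Bool, pattern K (flipAt t F) = pattern K F := by
      intro F
      refine pattern_congr fun s hs hs3 => ?_
      have : s ≠ t := by rintro rfl; exact ht ⟨hs, hs3⟩
      simp [flipAt, this]
    rw [conditionalWeight, conditionalWeight, h, h, pattern_congr hGH]

theorem one_div_le_prod_conditionalWeight {n : ℕ} {K : Finset (Fin n)} (hK : K.card = 5)
    {H : Finset (Fin n) → Bool} (hH : patternWeight (pattern K H) ≠ 0) :
    (1 / 300 : ℝ) ≤ ∏ t ∈ Finset.powersetCard 3 K, conditionalWeight K t H := by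
  have hP : Finset.powersetCard 3 K = Finset.univ.map
      ⟨fun i => (triple i).map (K.orderEmbOfFin hK).toEmbedding,
        (Finset.map_injective _).comp triple_injective⟩ := by
    conv_lhs => rw [← Finset.map_orderEmbOfFin_univ K hK, Finset.powersetCard_map, ← image_triple]
    ext t
    simp
  rw [hP, Finset.prod_map]
  simp only [Function.Embedding.coeFn_mk, conditionalWeight, pattern_flipAt hK]
  exact one_div_le_prod_patternWeight _ hH

/-- Double counting by `(D, t) ↦ (D ∪ t, t)`. It gathers the ten conditional weights of each
five-set, although each pair `D` uses only one of them. -/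
theorem prod_powersetCard_disjoint {n : ℕ} (f : Finset (Fin n) → Finset (Fin n) → ℝ) :
    ∏ D ∈ Finset.powersetCard 2 (Finset.univ : Finset (Fin n)),
      ∏ t ∈ Finset.powersetCard 3 Dᶜ, f (D ∪ t) t =
    ∏ K ∈ Finset.powersetCard 5 (Finset.univ : Finset (Fin n)),
      ∏ t ∈ Finset.powersetCard 3 K, f K t := by
  rw [Finset.prod_sigma', Finset.prod_sigma']
  refine Finset.prod_bij' (fun p _ => ⟨p.1 ∪ p.2, p.2⟩) (fun p _ => ⟨p.1 \ p.2, p.2⟩) ?_ ?_ ?_ ?_ ?_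
  · rintro ⟨D, t⟩ h
    simp only [Finset.mem_sigma, Finset.mem_powersetCard, Finset.subset_univ, true_and] at h ⊢
    have hd : Disjoint D t := (Finset.subset_compl_iff_disjoint_left.1 h.2.1)
    rw [Finset.card_union_of_disjoint hd]
    exact ⟨by omega, Finset.subset_union_right, h.2.2⟩
  · rintro ⟨K, t⟩ h
    simp only [Finset.mem_sigma, Finset.mem_powersetCard, Finset.subset_univ, true_and] at h ⊢
    rw [Finset.card_sdiff_of_subset h.2.1]
    refine ⟨by omega, ?_, h.2.2⟩
    rw [Finset.subset_compl_iff_disjoint_left]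
    exact Finset.sdiff_disjoint
  · rintro ⟨D, t⟩ h
    simp only [Finset.mem_sigma, Finset.mem_powersetCard, Finset.subset_univ, true_and] at h
    have hd : Disjoint D t := (Finset.subset_compl_iff_disjoint_left.1 h.2.1)
    simp [Finset.union_sdiff_cancel_right hd]
  · rintro ⟨K, t⟩ h
    simp only [Finset.mem_sigma, Finset.mem_powersetCard, Finset.subset_univ, true_and] at h
    simp [Finset.sdiff_union_of_subset h.2.1]
  · rintro ⟨D, t⟩ h
    rfl

/-- The conditional weight of the sign at `t`, where the signs of the triples meeting `D` are
equidistributed and the signs of the sets that are not triples are required to be `false`. -/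
noncomputable def factor {n : ℕ} (D t : Finset (Fin n)) (H : Finset (Fin n) → Bool) : ℝ :=
  if t.card = 3 then
    if Disjoint t D then conditionalWeight (D ∪ t) t H else 1 / 2
  else if H t then 0 else 1

theorem factor_nonneg {n : ℕ} (D t : Finset (Fin n)) (H : Finset (Fin n) → Bool) :
    0 ≤ factor D t H := by
  unfold factor
  split_ifs
  · exact conditionalWeight_nonneg _ _ _
  all_goals norm_num

theorem sum_prod_factor_le_one {n : ℕ} (D : Finset (Fin n)) :
    ∑ H, ∏ t, factor D t H ≤ 1 := by
  refine sum_prod_le_one (Finset.univ.filter fun t => ¬(t.card = 3 ∧ Disjoint t D)) _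
    (factor_nonneg D) ?_ ?_ ?_
  · intro t ht G H h
    have ht' := (Finset.mem_filter.1 ht).2
    by_cases h3 : t.card = 3
    · have hd : ¬Disjoint t D := fun hd => ht' ⟨h3, hd⟩
      simp [factor, h3, hd]
    · simp [factor, h3, h]
  · intro t ht G H hs h
    simp only [Finset.mem_filter, Finset.mem_univ, true_and, not_not] at ht hs
    rw [factor, factor, if_pos ht.1, if_pos ht.2, if_pos ht.1, if_pos ht.2]
    refine conditionalWeight_congr fun s hsK hs3 => ?_
    by_cases hsD : Disjoint s D
    -- The only triple of `D ∪ t` avoiding `D` is `t` itself.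
    · have hst : s ⊆ t := hsD.left_le_of_le_sup_left hsK
      rwa [Finset.eq_of_subset_of_card_le hst (by omega)]
    · exact hs s fun hc => hsD hc.2
  · intro t H
    by_cases h3 : t.card = 3
    · by_cases hd : Disjoint t D
      · simpa [factor, h3, hd] using conditionalWeight_add_le_one _ _ _
      · simp [factor, h3, hd]; norm_num
    · cases hH : H t <;> simp [factor, h3, flipAt, hH]

theorem prod_factor_eq {n : ℕ} {D : Finset (Fin n)} (hD : D.card = 2) {H : Finset (Fin n) → Bool}
    (hH : ∀ t, t.card ≠ 3 → H t = false) :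
    ∏ t, factor D t H = (1 / 2) ^ (n.choose 3 - (n - 2).choose 3) *
      ∏ t ∈ Finset.powersetCard 3 Dᶜ, conditionalWeight (D ∪ t) t H := by
  have hsub : Finset.powersetCard 3 Dᶜ ⊆ Finset.powersetCard 3 Finset.univ :=
    Finset.powersetCard_mono (Finset.subset_univ _)
  have h1 : ∏ t, factor D t H = ∏ t ∈ Finset.powersetCard 3 Finset.univ, factor D t H := by
    refine (Finset.prod_subset (Finset.subset_univ _) fun t _ ht => ?_).symm
    have h3 : t.card ≠ 3 := fun h => ht (Finset.mem_powersetCard.2 ⟨Finset.subset_univ _, h⟩)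
    simp [factor, h3, hH t h3]
  have h2 : ∀ t ∈ Finset.powersetCard 3 Finset.univ \ Finset.powersetCard 3 Dᶜ,
      factor D t H = 1 / 2 := by
    intro t ht
    simp only [Finset.mem_sdiff, Finset.mem_powersetCard, Finset.subset_univ, true_and] at ht
    have hd : ¬Disjoint t D := fun h => ht.2 ⟨Finset.subset_compl_iff_disjoint_right.2 h, ht.1⟩
    simp [factor, ht.1, hd]
  have h3 : ∀ t ∈ Finset.powersetCard 3 Dᶜ, factor D t H = conditionalWeight (D ∪ t) t H := by
    intro t ht
    rw [Finset.mem_powersetCard, Finset.subset_compl_iff_disjoint_right] at ht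
    simp [factor, ht.1, ht.2]
  rw [h1, ← Finset.prod_sdiff hsub, Finset.prod_congr rfl h2, Finset.prod_congr rfl h3,
    Finset.prod_const, Finset.card_sdiff_of_subset hsub, Finset.card_powersetCard,
    Finset.card_powersetCard, Finset.card_compl, hD, Finset.card_univ, Fintype.card_fin]

/-- A bound for families of 3-uniform hypergraphs whose five-element patterns all have positive
weight. -/
theorem card_hypergraphs_le {n : ℕ} (hn : 2 ≤ n) (S : Finset (Finset (Fin n) → Bool))
    (hS : ∀ H ∈ S, ∀ t, t.card ≠ 3 → H t = false)
    (hS' : ∀ H ∈ S, ∀ K : Finset (Fin n), K.card = 5 → patternWeight (pattern K H) ≠ 0) :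
    (S.card : ℝ) ≤ 2 ^ (n.choose 3 - (n - 2).choose 3) *
      (300 : ℝ) ^ (((n - 2).choose 3 : ℝ) / 10) := by
  set I := Finset.powersetCard 2 (Finset.univ : Finset (Fin n)) with hI
  have hIcard : I.card = n.choose 2 := by simp [hI]
  have hIne : I.Nonempty := by
    rw [← Finset.card_pos, hIcard]; exact Nat.choose_pos hn
  -- Each five-set contains ten pairs, so averaging over the pairs leaves `C(n-2,3)/10` factors
  -- `1/300`.
  have hchoose : ((n - 2).choose 3 : ℝ) / 10 * (n.choose 2 : ℝ) = n.choose 5 := by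
    rcases lt_or_ge n 5 with h5 | h5
    · rw [Nat.choose_eq_zero_of_lt (by omega : n - 2 < 3), Nat.choose_eq_zero_of_lt h5]; simp
    have h := Nat.choose_mul (n := n) (k := 5) (s := 2) (by norm_num)
    norm_num [Nat.choose] at h
    have h' : (n.choose 5 : ℝ) * 10 = n.choose 2 * (n - 2).choose 3 := by exact_mod_cast h
    linarith
  have h300 : ((300 : ℝ) ^ (((n - 2).choose 3 : ℝ) / 10)) ^ I.card = 300 ^ n.choose 5 := by
    rw [← Real.rpow_mul_natCast (by norm_num), hIcard, hchoose, Real.rpow_natCast]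
  have h := card_mul_le_one_of_geom_mean S I hIne (fun D H => ∏ t, factor D t H)
    (fun D H => Finset.prod_nonneg fun t _ => factor_nonneg D t H)
    (fun D _ => (Finset.sum_le_sum_of_subset_of_nonneg (Finset.subset_univ S)
      fun H _ _ => Finset.prod_nonneg fun t _ => factor_nonneg D t H).trans
        (sum_prod_factor_le_one D))
    (ρ := (2 ^ (n.choose 3 - (n - 2).choose 3) * (300 : ℝ) ^ (((n - 2).choose 3 : ℝ) / 10))⁻¹)
    (by positivity) ?_
  · rwa [← div_eq_mul_inv, div_le_one (by positivity)] at h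
  · intro H hH
    have e : ∀ D ∈ I, ∏ t, factor D t H = (1 / 2) ^ (n.choose 3 - (n - 2).choose 3) *
      ∏ t ∈ Finset.powersetCard 3 Dᶜ, conditionalWeight (D ∪ t) t H := fun D hD =>
        prod_factor_eq (Finset.mem_powersetCard.1 hD).2 (hS H hH)
    rw [Finset.prod_congr rfl e, Finset.prod_mul_distrib, Finset.prod_const,
      prod_powersetCard_disjoint fun K t => conditionalWeight K t H, mul_inv, mul_pow, inv_pow (_ ^ (_ / _) : ℝ),
      h300]
    have hK : ∏ K ∈ Finset.powersetCard 5 (Finset.univ : Finset (Fin n)), (1 / 300 : ℝ) ≤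
        ∏ K ∈ Finset.powersetCard 5 (Finset.univ : Finset (Fin n)),
          ∏ t ∈ Finset.powersetCard 3 K, conditionalWeight K t H :=
      Finset.prod_le_prod (fun _ _ => by norm_num) fun K hK =>
        one_div_le_prod_conditionalWeight (Finset.mem_powersetCard.1 hK).2
          (hS' H hH K (Finset.mem_powersetCard.1 hK).2)
    rw [Finset.prod_const, Finset.card_powersetCard, Finset.card_univ, Fintype.card_fin] at hK
    simp only [one_div, inv_pow] at hK ⊢
    gcongr

/-! ### From generalized signotopes to hypergraphs -/

/-- The hypergraph of increasing triples with positive sign. -/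
def positiveTriples {n : ℕ} (χ : (Fin 3 ↪ Fin n) → ℤˣ) (t : Finset (Fin n)) : Bool :=
  if h : t.card = 3 then decide (χ (t.orderEmbOfFin h).toEmbedding = 1) else false

theorem positiveTriples_map {n : ℕ} (χ : (Fin 3 ↪ Fin n) → ℤˣ) (f : Fin 3 ↪o Fin n) :
    positiveTriples χ (Finset.univ.map f.toEmbedding) = decide (χ f.toEmbedding = 1) := by
  have h : (Finset.univ.map f.toEmbedding).card = 3 := by simp
  have hf : f = (Finset.univ.map f.toEmbedding).orderEmbOfFin h :=
    Finset.orderEmbOfFin_unique' h (by simp)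
  rw [positiveTriples, dif_pos h, ← hf]

theorem positiveTriples_injective {n : ℕ} {χ ψ : (Fin 3 ↪ Fin n) → ℤˣ}
    (hχ : IsGeneralizedSignotope χ) (hψ : IsGeneralizedSignotope ψ)
    (h : positiveTriples χ = positiveTriples ψ) : χ = ψ := by
  ext1 t
  obtain ⟨σ, s, rfl⟩ := exists_perm_strictMono t
  have hs := congrFun h (Finset.univ.map s.toEmbedding)
  rw [positiveTriples_map, positiveTriples_map, decide_eq_decide] at hs
  rw [hχ.alternating, hψ.alternating]
  rcases Int.units_eq_one_or (χ s.toEmbedding) with h1 | h1 <;>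
    rcases Int.units_eq_one_or (ψ s.toEmbedding) with h2 | h2 <;> simp_all

theorem isAlternating_positiveTriples {n : ℕ} {χ : (Fin 3 ↪ Fin n) → ℤˣ}
    (hχ : IsGeneralizedSignotope χ) (q : Fin 4 ↪o Fin n) :
    let b : Fin 4 → Bool := fun k => positiveTriples χ
      ((Finset.univ.erase k).map q.toEmbedding)
    isAlternating (b 3) (b 2) (b 1) (b 0) = false := by
  intro b
  have hb : ∀ i : Fin 4, b i.rev = decide (tripleSigns χ q.toEmbedding i = 1) := by
    intro i
    have : (Finset.univ.erase i.rev).map q.toEmbedding =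
        Finset.univ.map ((Fin.succAboveOrderEmb i.rev).trans q).toEmbedding := by
      rw [show Finset.univ.erase i.rev = Finset.univ.map (Fin.succAboveEmb i.rev) by
        revert i; decide, Finset.map_map]
      rfl
    simp only [b, this, positiveTriples_map]
    rfl
  have h := hχ.signChanges_le_two q.toEmbedding
  have hs : ∀ s : Fin 4 → ℤˣ, signChanges s ≤ 2 → isAlternating (decide (s 0 = 1))
      (decide (s 1 = 1)) (decide (s 2 = 1)) (decide (s 3 = 1)) = false := by
    decide +kernel
  have := hs _ h
  rwa [← hb, ← hb, ← hb, ← hb] at this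

theorem patternWeight_positiveTriples_ne_zero {n : ℕ} {χ : (Fin 3 ↪ Fin n) → ℤˣ}
    (hχ : IsGeneralizedSignotope χ) {K : Finset (Fin n)} (hK : K.card = 5) :
    patternWeight (pattern K (positiveTriples χ)) ≠ 0 := by
  have key : ∀ o : Fin 5, ∀ i : Fin 4 → Fin 10, (∀ k, triple (i k) =
      (Finset.univ.erase k).map (Fin.succAboveEmb o)) →
      isAlternating (pattern K (positiveTriples χ) (i 3)) (pattern K (positiveTriples χ) (i 2))
        (pattern K (positiveTriples χ) (i 1)) (pattern K (positiveTriples χ) (i 0)) = false := by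
    intro o i hi
    have h := isAlternating_positiveTriples hχ ((Fin.succAboveOrderEmb o).trans (K.orderEmbOfFin hK))
    have e : ∀ k, pattern K (positiveTriples χ) (i k) = positiveTriples χ ((Finset.univ.erase k).map
        ((Fin.succAboveOrderEmb o).trans (K.orderEmbOfFin hK)).toEmbedding) := by
      intro k
      rw [pattern, dif_pos hK, hi, Finset.map_map]
      rfl
    simpa only [e] using h
  -- The list for `o` gives the lexicographic positions of the four triples avoiding `o`, in
  -- decreasing order because entry `k` omits the `k`-th remaining point.
  have h4 := key 4 ![6, 3, 1, 0] (by decide)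
  have h3 := key 3 ![7, 4, 2, 0] (by decide)
  have h2 := key 2 ![8, 5, 2, 1] (by decide)
  have h1 := key 1 ![9, 5, 4, 3] (by decide)
  have h0 := key 0 ![9, 8, 7, 6] (by decide)
  simp only [Matrix.cons_val] at h0 h1 h2 h3 h4
  rw [patternWeight, weight, h0, h1, h2, h3, h4]
  simp

theorem numGeneralizedSignotopes_le {n : ℕ} (hn : 2 ≤ n) :
    (numGeneralizedSignotopes n : ℝ) ≤ 2 ^ (n.choose 3 - (n - 2).choose 3) *
      (300 : ℝ) ^ (((n - 2).choose 3 : ℝ) / 10) := by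
  classical
  let S : Finset (Finset (Fin n) → Bool) :=
    (Finset.univ.filter fun χ : (Fin 3 ↪ Fin n) → ℤˣ => IsGeneralizedSignotope χ).image
      positiveTriples
  have hS : ∀ H ∈ S, ∃ χ : (Fin 3 ↪ Fin n) → ℤˣ,
      IsGeneralizedSignotope χ ∧ positiveTriples χ = H := by
    intro H hH
    simpa [S] using hH
  have hcard : numGeneralizedSignotopes n = S.card := by
    rw [numGeneralizedSignotopes, Nat.card_eq_fintype_card, Fintype.card_subtype,
      Finset.card_image_of_injOn]
    intro χ hχ ψ hψ h
    exact positiveTriples_injective (by simpa using hχ) (by simpa using hψ) h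
  rw [hcard]
  refine card_hypergraphs_le hn S ?_ ?_
  · intro H hH t ht
    obtain ⟨χ, -, rfl⟩ := hS H hH
    simp [positiveTriples, ht]
  · intro H hH K hK
    obtain ⟨χ, hχ, rfl⟩ := hS H hH
    exact patternWeight_positiveTriples_ne_zero hχ hK

/-! ### Comparison of the constants -/

theorem choose_three_sub_choose_three (k : ℕ) : (k + 2).choose 3 - k.choose 3 = k ^ 2 := by
  have h1 : (k + 2).choose 3 = (k + 1).choose 2 + (k + 1).choose 3 := Nat.choose_succ_succ' _ _
  have h2 : (k + 1).choose 3 = k.choose 2 + k.choose 3 := Nat.choose_succ_succ' _ _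
  have h3 : (k + 1).choose 2 = k + k.choose 2 := by
    have := Nat.choose_succ_succ' k 1
    simpa using this
  have h4 : k + 2 * k.choose 2 = k ^ 2 := by
    have h6 : 2 * k.choose 2 = k * (k - 1) := by
      rw [Nat.choose_two_right]; exact Nat.mul_div_cancel' (Nat.even_mul_pred_self k).two_dvd
    rw [h6]
    rcases k with _ | k
    · rfl
    · simp; ring
  omega

theorem pow_three_le_six_mul_choose (k : ℕ) : k ^ 3 ≤ 6 * (k + 2).choose 3 := by
  have h := Nat.pow_sub_le_descFactorial (k + 2) 3
  rwa [Nat.descFactorial_eq_factorial_mul_choose, show k + 2 + 1 - 3 = k by omega] at h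

theorem log_lt_log_count : Real.log 300 / 10 < Real.log 630988832 / 35 := by
  have h : Real.log ((300 : ℝ) ^ 7) < Real.log ((630988832 : ℝ) ^ 2) :=
    Real.log_lt_log (by norm_num) (by norm_num)
  rw [Real.log_pow, Real.log_pow] at h
  push_cast at h
  linarith

set_option exponentiation.threshold 1000 in
theorem abs_logb_sub_lt : |Real.logb 2 630988832 / 35 - 0.8352| < 0.00005 := by
  have h2 : (0 : ℝ) < Real.log 2 := Real.log_pos (by norm_num)
  -- The fractions `877/30` and `380/13` enclose the binary logarithm tightly enough: divided by 35
  -- they are about 0.83524 and 0.83516.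
  have hu : Real.log ((630988832 : ℝ) ^ 30) < Real.log ((2 : ℝ) ^ 877) :=
    Real.log_lt_log (by norm_num) (by norm_num)
  have hl : Real.log ((2 : ℝ) ^ 380) < Real.log ((630988832 : ℝ) ^ 13) :=
    Real.log_lt_log (by norm_num) (by norm_num)
  rw [Real.log_pow, Real.log_pow] at hu hl
  push_cast at hu hl
  have hu' : Real.logb 2 630988832 < 877 / 30 := by
    rw [Real.logb, div_lt_iff₀ h2]; linarith
  have hl' : 380 / 13 < Real.logb 2 630988832 := by
    rw [Real.logb, lt_div_iff₀ h2]; linarith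
  rw [abs_lt]
  constructor <;> norm_num <;> linarith

theorem eventually_numGeneralizedSignotopes_le : ∀ᶠ n : ℕ in atTop,
    (numGeneralizedSignotopes n : ℝ) ≤
      (2 : ℝ) ^ (Real.logb 2 630988832 / 35 * (n.choose 3 : ℝ)) := by
  -- Beyond this threshold the gap between the constants, times `k ^ 3 / 6`, absorbs the loss `k ^ 2
  -- * log 2` from the triples meeting `D`.
  obtain ⟨N, hN⟩ := exists_nat_gt
    (6 * Real.log 2 / (Real.log 630988832 / 35 - Real.log 300 / 10))
  filter_upwards [eventually_ge_atTop (N + 2)] with n hn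
  obtain ⟨k, rfl⟩ : ∃ k, n = k + 2 := ⟨n - 2, by omega⟩
  have hlog := sub_pos.2 log_lt_log_count
  have hNk : (N : ℝ) ≤ k := by exact_mod_cast (by omega : N ≤ k)
  have hk : 6 * Real.log 2 ≤ k * (Real.log 630988832 / 35 - Real.log 300 / 10) := by
    rw [div_lt_iff₀ hlog] at hN
    nlinarith
  have hpow : (k : ℝ) ^ 3 ≤ 6 * (k + 2).choose 3 := by exact_mod_cast pow_three_le_six_mul_choose k
  have hmono : (k.choose 3 : ℝ) ≤ (k + 2).choose 3 := by
    exact_mod_cast Nat.choose_le_choose 3 (by omega)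
  have h300 : 0 ≤ Real.log 300 := Real.log_nonneg (by norm_num)
  refine (numGeneralizedSignotopes_le (by omega)).trans ?_
  rw [Nat.add_sub_cancel, choose_three_sub_choose_three,
    ← Real.log_le_log_iff (by positivity) (by positivity),
    Real.log_mul (by positivity) (by positivity), Real.log_pow, Real.log_rpow (by norm_num),
    Real.log_rpow (by norm_num), Real.logb]
  have h2 : Real.log 2 ≠ 0 := (Real.log_pos (by norm_num)).ne'
  have e : Real.log 630988832 / Real.log 2 / 35 * ((k + 2).choose 3 : ℝ) * Real.log 2 =
      Real.log 630988832 / 35 * (k + 2).choose 3 := by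
    field_simp
  rw [e]
  push_cast
  have h1 : (k : ℝ) ^ 2 * (6 * Real.log 2) ≤
      6 * (k + 2).choose 3 * (Real.log 630988832 / 35 - Real.log 300 / 10) := by
    calc (k : ℝ) ^ 2 * (6 * Real.log 2)
        ≤ (k : ℝ) ^ 2 * (k * (Real.log 630988832 / 35 - Real.log 300 / 10)) := by gcongr
      _ = (k : ℝ) ^ 3 * (Real.log 630988832 / 35 - Real.log 300 / 10) := by ring
      _ ≤ _ := by gcongr
  have h3 : (k.choose 3 : ℝ) / 10 * Real.log 300 ≤ (k + 2).choose 3 / 10 * Real.log 300 := by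
    gcongr
  linarith

theorem theorem4 :
    (∃ e : ℕ → ℝ, e =o[atTop] (fun n : ℕ => (n : ℝ) ^ 3) ∧
      ∀ n : ℕ, (2 : ℝ) ^ ((0.25 : ℝ) * (n.choose 3 : ℝ) + e n) ≤
        (numGeneralizedSignotopes n : ℝ)) ∧
    ∃ c₂ : ℝ, c₂ = Real.logb 2 630988832 / 35 ∧ |c₂ - 0.8352| < 0.00005 ∧
      ∃ e : ℕ → ℝ, e =o[atTop] (fun _ : ℕ => (1 : ℝ)) ∧
        ∀ n : ℕ, (numGeneralizedSignotopes n : ℝ) ≤ (2 : ℝ) ^ (c₂ * (n.choose 3 : ℝ)) + e n := by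
  -- The lower bound needs no error term; the upper error is the positive part of the excess, which
  -- vanishes for large `n`.
  refine ⟨⟨0, isLittleO_zero _ _, fun n => ?_⟩, _, rfl, abs_logb_sub_lt,
    fun n => max 0 ((numGeneralizedSignotopes n : ℝ) -
      (2 : ℝ) ^ (Real.logb 2 630988832 / 35 * (n.choose 3 : ℝ))), ?_, fun n => ?_⟩
  · simpa using two_rpow_quarter_choose_three_le n
  · refine (isLittleO_zero _ _).congr' ?_ EventuallyEq.rfl
    filter_upwards [eventually_numGeneralizedSignotopes_le] with n hn
    exact (max_eq_left (sub_nonpos.2 hn)).symm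
  · have := le_max_right 0 ((numGeneralizedSignotopes n : ℝ) -
      (2 : ℝ) ^ (Real.logb 2 630988832 / 35 * (n.choose 3 : ℝ)))
    linarith
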